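/- Model. Let $G$ be a finite, simple, connected, anonymous graph with $n$ nodes, $m$ edges, maximum degree $\Delta$ and diameter $D$. The edges at each node $v$ carry arbitrary local port numbers $0,\dots,\deg(v)-1$, chosen independently at the two ends of an edge. There are $n$ mobile agents, initially exactly one at each node, with distinct integer IDs in $[0,n^c]$; $\lambda$ is the highest ID. All agents run the same deterministic algorithm in synchronous rounds. Initially an agent knows only its own ID and the values $\Delta$, $D$, $\lambda$; all that it keeps from one round to the next, these values included, is stored in its memory, a string of bits. In each round an agent sees its own memory, the degree of its current node, the port through which it has just entered (if it moved) and the memories of the other agents at the same node; from this it computes its new memory and then stays or leaves through a port of its choice. Local computation is unrestricted. For a graph $H$, the support of an edge in $H$ is the number of triangles of $H$ that contain it. The $k$-truss $T_k$ of $G$ is the largest subgraph of $G$ in which every edge has support at least $k-2$ with respect to that subgraph. The trussness of an edge $e$ of $G$ is the largest $k$ such that $e$ belongs to $T_k$ but not to $T_{k+1}$. Theorem. There are an algorithm and a constant $K$, and for every constant $c$ a constant $C$, such that for all $G$, port numberings and IDs as above (with this $c$) the following holds. Within $K\cdot m\Delta D\log\lambda$ rounds all agents have terminated, and each agent outputs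 the trussness of every edge at its home node, the edge being named by the ID of the agent whose home is its other end. The memory of every agent never exceeds $C\cdot\Delta\log n$ bits. That is, truss decomposition is solved in $O(m\Delta D\log\lambda)$ rounds with $O(\Delta\log n)$ bits of memory per agent. (For $n=1$ there are no edges and both bounds are read as $0$.) -/

import Mathlib

/-! ### Trusses -/

/-- The support of `e` in `H`: the number of triangles of `H` that contain `e`. -/
noncomputable def edgeSupport {V : Type*} (H : SimpleGraph V) (e : Sym2 V) : ℕ :=
  Set.ncard {t : Finset V | H.IsNClique 3 t ∧ ∀ x ∈ e, x ∈ t}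

/-- Every edge of `H` has support at least `k - 2` with respect to `H`
(written without truncated subtraction). -/
def HasTrussProperty {V : Type*} (k : ℕ) (H : SimpleGraph V) : Prop :=
  ∀ e ∈ H.edgeSet, k ≤ edgeSupport H e + 2

/-- The `k`-truss of `G`: the largest subgraph of `G` in which every edge has support at least
`k - 2` (see `kTruss_isGreatest`). Subgraphs are taken on the same vertex set, so only their
edges matter. -/
def kTruss {V : Type*} (G : SimpleGraph V) (k : ℕ) : SimpleGraph V :=
  sSup {H : SimpleGraph V | H ≤ G ∧ HasTrussProperty k H}

/-- The trussness of `e`: the largest `k` such that `e` belongs to the `k`-truss but not to the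
`(k+1)`-truss (see `trussness_isGreatest`). -/
noncomputable def trussness {V : Type*} (G : SimpleGraph V) (e : Sym2 V) : ℕ :=
  sSup {k : ℕ | e ∈ (kTruss G k).edgeSet ∧ e ∉ (kTruss G (k + 1)).edgeSet}

theorem edgeSupport_mono {V : Type*} [Finite V] {H H' : SimpleGraph V} (h : H ≤ H')
    (e : Sym2 V) : edgeSupport H e ≤ edgeSupport H' e := by
  apply Set.ncard_le_ncard _ (Set.toFinite _)
  rintro t ⟨ht, he⟩
  exact ⟨ht.mono h, he⟩

theorem kTruss_isGreatest {V : Type*} [Finite V] (G : SimpleGraph V) (k : ℕ) :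
    IsGreatest {H : SimpleGraph V | H ≤ G ∧ HasTrussProperty k H} (kTruss G k) := by
  refine ⟨⟨sSup_le fun H hH => hH.1, ?_⟩, fun H hH => le_sSup hH⟩
  intro e he
  induction e using Sym2.ind with
  | _ x y =>
    rw [SimpleGraph.mem_edgeSet, kTruss, SimpleGraph.sSup_adj] at he
    obtain ⟨H, hH, hxy⟩ := he
    have h1 := hH.2 s(x, y) hxy
    have h2 := edgeSupport_mono (le_sSup hH : H ≤ kTruss G k) s(x, y)
    exact h1.trans (Nat.add_le_add_right h2 2)

theorem trussness_isGreatest {V : Type*} [Finite V] (G : SimpleGraph V) {e : Sym2 V}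
    (he : e ∈ G.edgeSet) :
    IsGreatest {k : ℕ | e ∈ (kTruss G k).edgeSet ∧ e ∉ (kTruss G (k + 1)).edgeSet}
      (trussness G e) := by
  have hb : ∀ k, e ∈ (kTruss G k).edgeSet → k ≤ edgeSupport G e + 2 := by
    intro k hk
    have h1 := (kTruss_isGreatest G k).1.2 e hk
    have h2 := edgeSupport_mono (kTruss_isGreatest G k).1.1 e
    omega
  have hbdd : BddAbove {k : ℕ | e ∈ (kTruss G k).edgeSet ∧ e ∉ (kTruss G (k + 1)).edgeSet} :=
    ⟨edgeSupport G e + 2, fun k hk => hb k hk.1⟩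
  have h0 : e ∈ (kTruss G 0).edgeSet :=
    SimpleGraph.edgeSet_mono
      ((kTruss_isGreatest G 0).2 ⟨le_rfl, fun _ _ => Nat.zero_le _⟩) he
  have hne : {k : ℕ | e ∈ (kTruss G k).edgeSet ∧ e ∉ (kTruss G (k + 1)).edgeSet}.Nonempty := by
    by_contra hcon
    have hall : ∀ k, e ∈ (kTruss G k).edgeSet := by
      intro k
      induction k with
      | zero => exact h0
      | succ k ih =>
        by_contra hk
        exact hcon ⟨k, ih, hk⟩
    have := hb _ (hall (edgeSupport G e + 3))
    omega
  exact ⟨Nat.sSup_mem hne hbdd, fun k hk => le_csSup hbdd hk⟩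

/-! ### Mobile agents on an anonymous port-labelled graph -/

/-- A local port numbering: the edges at `v` carry the numbers `0, …, deg v - 1`. The two ends of
an edge are numbered independently. -/
abbrev PortNumbering {V : Type*} [Fintype V] (G : SimpleGraph V) [DecidableRel G.Adj] : Type _ :=
  ∀ v : V, G.neighborSet v ≃ Fin (G.degree v)

/-- The deterministic algorithm that all agents run. The memory of an agent is a bit string, and
everything that an agent keeps from one round to the next (its own ID and the values
`Δ`, `D`, `lam` included) has to be written there. -/
structure AgentAlgorithm where
  /-- Initial memory of an agent, from the maximum degree `Δ`, the diameter `D`, the highest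
  agent ID `lam` and its own identifier `ownID`. -/
  init : (Δ D lam ownID : ℕ) → List Bool
  /-- One Communicate-Compute-Move cycle. Input: own memory, degree of the current node, port
  through which the node was entered in the preceding round (`none` if the agent did not move),
  memories of the other agents at the node. Output: new memory, exit port (`none` to stay). -/
  step : (mem : List Bool) → (deg : ℕ) → (entry : Option ℕ) → (others : Multiset (List Bool)) →
    List Bool × Option ℕ
  /-- Whether an agent with this memory has terminated. -/
  halted : List Bool → Bool
  /-- What an agent with this memory outputs: `output mem j = some k` reports the trussness `k` for
  an edge between the agent's own node and the node of the agent with ID `j`. -/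
  output : List Bool → ℕ → Option ℕ

/-- Momentary situation of one agent. -/
structure AgentState (V : Type*) where
  pos : V
  mem : List Bool
  entry : Option ℕ

section Dynamics

variable {V : Type*} [Fintype V] [DecidableEq V] (G : SimpleGraph V) [DecidableRel G.Adj]

/-- The move of an agent at `v` with memory `mem` that chooses the exit port `p`; it stays where it
is if it chooses none (or a number that is not a port of `v`). -/
def moveAgent (ports : PortNumbering G) (v : V) (mem : List Bool) (p : Option ℕ) :
    AgentState V :=
  match p with
  | none => ⟨v, mem, none⟩
  | some q =>
    if h : q < G.degree v then
      let w := (ports v).symm ⟨q, h⟩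
      ⟨w, mem, some (ports w ⟨v, SimpleGraph.Adj.symm w.2⟩ : ℕ)⟩
    else ⟨v, mem, none⟩

/-- One synchronous round. In the initial dispersed configuration every node holds exactly one
agent, so agents are indexed by their starting nodes. A terminated agent stays where it is with its
memory unchanged (which others can still read). -/
def agentRound (A : AgentAlgorithm) (ports : PortNumbering G) (σ : V → AgentState V) :
    V → AgentState V := fun a =>
  if A.halted (σ a).mem then ⟨(σ a).pos, (σ a).mem, none⟩
  else
    let others : Multiset (List Bool) :=
      (Finset.univ.filter fun b => b ≠ a ∧ (σ b).pos = (σ a).pos).val.map fun b => (σ b).mem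
    let r := A.step (σ a).mem (G.degree (σ a).pos) (σ a).entry others
    moveAgent G ports (σ a).pos r.1 r.2

/-- The highest agent ID. -/
def highestID (ids : V → ℕ) : ℕ := Finset.univ.sup ids

/-- The situation of all agents after `t` rounds, from the dispersed configuration in which the
agent with ID `ids v` is at `v`. -/
noncomputable def agentRun (A : AgentAlgorithm) (ports : PortNumbering G) (ids : V → ℕ) :
    ℕ → V → AgentState V
  | 0 => fun v => ⟨v, A.init G.maxDegree G.diam (highestID ids) (ids v), none⟩
  | t + 1 => agentRound G A ports (agentRun A ports ids t)

/-- After `T` rounds all agents have terminated, and every agent outputs exactly the edges at its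
home node, named by the IDs of the agents of the neighbouring nodes, with their trussness. -/
def SolvesTrussDecomposition (A : AgentAlgorithm) (ports : PortNumbering G) (ids : V → ℕ)
    (T : ℕ) : Prop :=
  ∀ v : V, A.halted (agentRun G A ports ids T v).mem = true ∧
    ∀ j k : ℕ, A.output (agentRun G A ports ids T v).mem j = some k ↔
      ∃ w : V, G.Adj v w ∧ ids w = j ∧ trussness G s(v, w) = k

end Dynamics

/-!
The agents compute trussness by iterating a local rule. Every edge carries an estimate, `Δ + 1` at
first; in each phase the estimate of `e` drops to the largest `k` for which at least `k - 2`
triangles at `e` have two other edges with estimates at least `k`. The estimates never fall below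
the trussness (`trussness_le_estimate`), and when they are stable, the edges with estimate at least
`k` form a subgraph with the `k`-truss property, so that the estimates are the trussness values
(`estimate_eq_trussness`). As long as some estimates are too high, one of them becomes correct in
the next phase (`exists_estimate_eq_trussness`): if `k` is the least trussness of an edge with
a wrong estimate and no such edge dropped to `k`, the edges with estimate above `k` would have the
`(k+1)`-truss property. Hence stability is reached after `O(m)` phases (`exists_estimate_stable`).

To apply the rule to the edge `vw`, the agent from `v` needs only its own table of estimates and the
one of the agent from `w`; it can do so at the moment of meeting that agent, and remembers only the
result. Two neighbours cannot simply visit each other, as they might pass on the way. A phase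
therefore has one slot of two rounds for each port, bit position and bit value: the agents whose ID
has this bit value at this position go out through this port and come back, and all others stay at
home. As the IDs of two neighbours differ at some position, each of them is visited by the other one
while at home (`seen_all`). A phase takes `O(Δ log λ)` rounds.

Termination is detected by alarms. An agent whose table changes sets its alarm to `D + 1`; otherwise
its new alarm is one less than the largest alarm among itself and its neighbours. A change is
noticed everywhere within `D` phases, so no alarm is `0` up to `D` phases after the last change
(`alarmLevel_pos`), and in the phase after that all alarms are `0` together
(`alarmLevel_eq_zero`). This gives `O(m + D)` phases and `O(mΔD log λ)` rounds. The memory consists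
of `O(Δ)` numbers of `O(log λ)` bits, where `λ ≤ n ^ c`.

If the highest ID is `1`, the bound on the number of rounds is `0`. Then a graph with
more than one node is a single edge, and the agents know the result from the start. If there is only
one node, the bound on the memory is `0` too, and the memory is the empty string.
-/

/-! ### Binary encoding of memories -/

/-- Self-delimiting binary code of a natural number: every binary digit is preceded by `true`, and
`false` marks the end. -/
def bitCode (x : ℕ) : List Bool :=
  x.bits.flatMap (fun b => [true, b]) ++ [false]

theorem length_bitCode (x : ℕ) : (bitCode x).length = 2 * x.size + 1 := by
  have h (l : List Bool) : (l.flatMap (fun b => [true, b])).length = 2 * l.length := by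
    induction l with
    | nil => rfl
    | cons a l ih => simp [ih]; ring
  rw [bitCode, List.length_append, h, Nat.size_eq_bits_len]
  rfl

theorem bitCode_append_inj {x y : ℕ} {r s : List Bool}
    (h : bitCode x ++ r = bitCode y ++ s) : x = y ∧ r = s := by
  have key (l l' : List Bool)
      (h : l.flatMap (fun b => [true, b]) ++ [false] ++ r =
        l'.flatMap (fun b => [true, b]) ++ [false] ++ s) : l = l' ∧ r = s := by
    induction l generalizing l' with
    | nil => cases l' <;> simp_all
    | cons a l ih =>
      cases l' with
      | nil => simp at h
      | cons b l' =>
        simp only [List.flatMap_cons, List.cons_append, List.nil_append, List.cons.injEq,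
          true_and] at h
        obtain ⟨rfl, h⟩ := h
        obtain ⟨rfl, hrs⟩ := ih l' h
        exact ⟨rfl, hrs⟩
  obtain ⟨hb, hrs⟩ := key _ _ h
  refine ⟨?_, hrs⟩
  apply Nat.eq_of_testBit_eq
  intro i
  rw [Nat.testBit_eq_inth, Nat.testBit_eq_inth, hb]

/-- Bit string that encodes a list of natural numbers. -/
def natListCode (l : List ℕ) : List Bool := l.flatMap bitCode

theorem natListCode_injective : Function.Injective natListCode := by
  intro l
  induction l with
  | nil =>
    intro l' h
    cases l' with
    | nil => rfl
    | cons b l' => simp [natListCode, bitCode] at h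
  | cons a l ih =>
    intro l' h
    cases l' with
    | nil => simp [natListCode, bitCode] at h
    | cons b l' =>
      obtain ⟨rfl, h'⟩ : a = b ∧ natListCode l = natListCode l' := bitCode_append_inj h
      rw [ih h']

theorem length_natListCode_le {l : List ℕ} {k : ℕ} (h : ∀ x ∈ l, x < 2 ^ k) :
    (natListCode l).length ≤ l.length * (2 * k + 1) := by
  induction l with
  | nil => simp [natListCode]
  | cons a l ih =>
    have h1 : a.size ≤ k := Nat.size_le.2 (h a (by simp))
    have h2 := ih fun x hx => h x (by simp [hx])
    simp only [natListCode, List.flatMap_cons, List.length_append, length_bitCode,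
      List.length_cons] at h2 ⊢
    linarith

/-- What an agent remembers. -/
@[ext]
structure AgentMemory where
  /-- The maximum degree of the graph. -/
  maxDeg : ℕ
  /-- The diameter of the graph. -/
  diam : ℕ
  /-- The highest agent ID. -/
  lam : ℕ
  /-- The agent's own ID. -/
  ownID : ℕ
  /-- The number of rounds since the beginning of the current phase. -/
  clock : ℕ
  /-- The countdown to termination; it is set back whenever an estimate changes. -/
  alarm : ℕ
  /-- The largest alarm of the neighbours met in the current phase. -/
  heard : ℕ
  /-- The current estimates: a pair `(j, k)` says that the edge to the agent with ID `j` has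
  estimated trussness `k`. -/
  table : Finset (ℕ × ℕ)
  /-- The estimates for the next phase that have been computed so far. -/
  draft : Finset (ℕ × ℕ)

namespace AgentMemory

/-- The memory as a list of numbers. The cardinality of the table separates the two tables. -/
noncomputable def toNats (m : AgentMemory) : List ℕ :=
  [m.maxDeg, m.diam, m.lam, m.ownID, m.clock, m.alarm, m.heard, m.table.card] ++
    (m.table.toList.map Nat.pairEquiv ++ m.draft.toList.map Nat.pairEquiv)

theorem toNats_injective : Function.Injective toNats := by
  intro m m' h
  simp only [toNats, List.cons_append, List.nil_append, List.cons.injEq] at h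
  obtain ⟨h1, h2, h3, h4, h5, h6, h7, h8, h⟩ := h
  have hl : (m.table.toList.map Nat.pairEquiv).length =
      (m'.table.toList.map Nat.pairEquiv).length := by simpa using h8
  obtain ⟨ht, hd⟩ := List.append_inj h hl
  have aux {s t : Finset (ℕ × ℕ)}
      (h : s.toList.map Nat.pairEquiv = t.toList.map Nat.pairEquiv) : s = t := by
    have := List.map_injective_iff.2 Nat.pairEquiv.injective h
    rw [← s.toList_toFinset, this, t.toList_toFinset]
  exact AgentMemory.ext h1 h2 h3 h4 h5 h6 h7 (aux ht) (aux hd)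

/-- The memory as a bit string. -/
noncomputable def code (m : AgentMemory) : List Bool := natListCode m.toNats

theorem code_injective : Function.Injective code :=
  natListCode_injective.comp toNats_injective

theorem code_ne_nil (m : AgentMemory) : m.code ≠ [] := by
  simp [code, toNats, natListCode, bitCode]

/-- The memory encoded by a bit string. A string that encodes nothing, such as `[]`, is read as the
memory with alarm `0` and empty tables. -/
noncomputable def decode : List Bool → AgentMemory :=
  Function.extend code id fun _ => ⟨0, 0, 0, 0, 0, 0, 0, ∅, ∅⟩

@[simp]
theorem decode_code (m : AgentMemory) : decode m.code = m :=
  code_injective.extend_apply id _ m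

theorem decode_nil : decode [] = ⟨0, 0, 0, 0, 0, 0, 0, ∅, ∅⟩ :=
  Function.extend_apply' _ _ _ fun ⟨m, hm⟩ => m.code_ne_nil hm

/-- A code is short if the numbers in the memory have at most `k` bits each and the tables have at
most `d` entries. -/
theorem length_code_le {m : AgentMemory} {d k : ℕ} (hΔ : m.maxDeg < 2 ^ k) (hD : m.diam < 2 ^ k)
    (hlam : m.lam < 2 ^ k) (hid : m.ownID < 2 ^ k) (hc : m.clock < 2 ^ k) (ha : m.alarm < 2 ^ k)
    (hh : m.heard < 2 ^ k) (htd : m.table.card ≤ d) (hdk : d < 2 ^ k) (hdd : m.draft.card ≤ d)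
    (ht : ∀ x ∈ m.table, Nat.pairEquiv x < 2 ^ k) (hd : ∀ x ∈ m.draft, Nat.pairEquiv x < 2 ^ k) :
    m.code.length ≤ (8 + 2 * d) * (2 * k + 1) := by
  refine (length_natListCode_le (k := k) ?_).trans (Nat.mul_le_mul_right _ ?_)
  · intro x hx
    simp only [toNats, List.mem_append, List.mem_cons, List.not_mem_nil, or_false, List.mem_map,
      Finset.mem_toList] at hx
    rcases hx with (h | h | h | h | h | h | h | h) | ⟨y, hy, rfl⟩ | ⟨y, hy, rfl⟩
    all_goals first | exact ht y hy | exact hd y hy | (rw [h]; first | assumption | omega)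
  · simp [toNats]
    omega

end AgentMemory

/-! ### The algorithm -/

/-- The estimate for the edge to the agent with ID `j`, and `0` if there is none. -/
def lookup (T : Finset (ℕ × ℕ)) (j : ℕ) : ℕ :=
  (T.filter fun x => x.1 = j).sup Prod.snd

/-- The next estimate for the edge to the agent with ID `j`, from the tables at both ends: the
largest `k` up to the present estimate such that at least `k - 2` triangles at this edge have two
other edges with estimates at least `k`. If there is no estimate yet, it is `Δ + 1`. -/
def refineTable (Δ : ℕ) (own other : Finset (ℕ × ℕ)) (j : ℕ) : ℕ :=
  if lookup own j = 0 then Δ + 1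
  else Nat.findGreatest
    (fun k => k ≤ ((own.image Prod.fst ∩ other.image Prod.fst).filter
      fun i => k ≤ lookup own i ∧ k ≤ lookup other i).card + 2)
    (lookup own j)

/-- A slot lasts two rounds. Slot `s` of a phase stands for a port `s % Δ`, a bit position
`s / Δ / 2` and a bit value `s / Δ % 2`; it is for the agents whose ID has this value there. -/
def isMover (Δ s j : ℕ) : Bool :=
  j.testBit (s / Δ / 2) == decide (s / Δ % 2 = 1)

namespace AgentMemory

/-- A phase has a slot for every port, bit position and bit value. -/
def slots (m : AgentMemory) : ℕ := 2 * m.maxDeg * m.lam.size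

/-- An agent at home computes the new estimates for the edges to its visitors. -/
def learn (m : AgentMemory) (os : Multiset AgentMemory) : AgentMemory :=
  { m with
    heard := m.heard ⊔ (os.map alarm).sup
    draft := m.draft ∪
      (os.map fun o => (o.ownID, refineTable m.maxDeg m.table o.table o.ownID)).toFinset }

/-- The clock advances. At the end of a phase the draft becomes the table, and the alarm is set
back to its maximum if this changes the table, and otherwise follows the alarms heard. -/
def tick (m : AgentMemory) : AgentMemory :=
  if m.clock + 1 = 2 * m.slots then
    { m with
      clock := 0
      alarm := if m.draft = m.table then (m.alarm ⊔ m.heard) - 1 else m.diam + 1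
      heard := 0
      table := m.draft
      draft := ∅ }
  else { m with clock := m.clock + 1 }

/-- The initial memory. If `lam ≤ 1` then the graph has at most one edge, and the result is known
from the start. -/
def initial (Δ D lam j : ℕ) : AgentMemory where
  maxDeg := Δ
  diam := D
  lam := lam
  ownID := j
  clock := 0
  alarm := if lam ≤ 1 then 0 else D + 1
  heard := 0
  table := if lam ≤ 1 then {(1 - j, 2)} else ∅
  draft := ∅

end AgentMemory

open AgentMemory in
/-- The algorithm. In even rounds the movers of the slot leave; in odd rounds they return, and the
agents that stayed at home (which have entered through no port) learn from their visitors. -/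
noncomputable def trussAlgorithm : AgentAlgorithm where
  init Δ D lam j := if Δ = 0 then [] else (initial Δ D lam j).code
  step mem _ entry others :=
    let m := decode mem
    if m.clock % 2 = 0 then
      (m.tick.code,
        if isMover m.maxDeg (m.clock / 2) m.ownID then some (m.clock / 2 % m.maxDeg) else none)
    else
      ((if entry = none then m.learn (others.map decode) else m).tick.code, entry)
  halted mem := (decode mem).alarm = 0
  output mem j :=
    if lookup (decode mem).table j = 0 then none else some (lookup (decode mem).table j)

/-! ### Supports and trussness -/

/-- Triangles at an edge correspond to common neighbours of its ends. -/
theorem edgeSupport_eq_card {V : Type*} [Fintype V] (H : SimpleGraph V) [DecidableRel H.Adj]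
    {v w : V} (h : H.Adj v w) :
    edgeSupport H s(v, w) = (Finset.univ.filter fun x => H.Adj v x ∧ H.Adj w x).card := by
  classical
  have himg : {t : Finset V | H.IsNClique 3 t ∧ ∀ x ∈ s(v, w), x ∈ t} =
      (fun x => ({v, w, x} : Finset V)) '' {x | H.Adj v x ∧ H.Adj w x} := by
    ext t
    simp only [Set.mem_ofPred_eq, Set.mem_image]
    constructor
    · rintro ⟨ht, hvw⟩
      have hv : v ∈ t := hvw v (by simp)
      have hw : w ∈ t := hvw w (by simp)
      have hsub : ({v, w} : Finset V) ⊆ t := by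
        intro x hx
        simp only [Finset.mem_insert, Finset.mem_singleton] at hx
        rcases hx with rfl | rfl <;> assumption
      have hcard : (t \ {v, w}).card = 1 := by
        rw [Finset.card_sdiff_of_subset hsub, ht.card_eq, Finset.card_pair h.ne]
      obtain ⟨x, hx⟩ := Finset.card_eq_one.1 hcard
      have hxt : x ∈ t \ {v, w} := by simp [hx]
      simp only [Finset.mem_sdiff, Finset.mem_insert, Finset.mem_singleton, not_or] at hxt
      refine ⟨x, ⟨ht.isClique hv hxt.1 (Ne.symm hxt.2.1), ht.isClique hw hxt.1 (Ne.symm hxt.2.2)⟩,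
        ?_⟩
      rw [← Finset.sdiff_union_of_subset hsub, hx]
      ext y
      simp
      tauto
    · rintro ⟨x, ⟨hvx, hwx⟩, rfl⟩
      refine ⟨SimpleGraph.is3Clique_triple_iff.2 ⟨h, hvx, hwx⟩, ?_⟩
      simp
  have hinj : Set.InjOn (fun x => ({v, w, x} : Finset V)) {x | H.Adj v x ∧ H.Adj w x} := by
    rintro x ⟨hvx, hwx⟩ y - hxy
    have : x ∈ ({v, w, y} : Finset V) := by
      rw [← show ({v, w, x} : Finset V) = {v, w, y} from hxy]
      simp
    simpa [hvx.ne', hwx.ne'] using this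
  rw [edgeSupport, himg, hinj.ncard_image, ← Set.ncard_coe_finset]
  congr 1
  ext x
  simp

theorem kTruss_antitone {V : Type*} [Finite V] (G : SimpleGraph V) : Antitone (kTruss G) := by
  intro k l hkl
  obtain ⟨hle, htp⟩ := (kTruss_isGreatest G l).1
  exact (kTruss_isGreatest G k).2 ⟨hle, fun e he => hkl.trans (htp e he)⟩

theorem mem_kTruss_iff_le_trussness {V : Type*} [Finite V] (G : SimpleGraph V) {e : Sym2 V}
    (he : e ∈ G.edgeSet) (k : ℕ) : e ∈ (kTruss G k).edgeSet ↔ k ≤ trussness G e := by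
  obtain ⟨hmem, hnot⟩ := (trussness_isGreatest G he).1
  refine ⟨fun h => ?_, fun h => SimpleGraph.edgeSet_mono (kTruss_antitone G h) hmem⟩
  by_contra! hlt
  exact hnot (SimpleGraph.edgeSet_mono (kTruss_antitone G hlt) h)

/-! ### Estimates of the trussness -/

section Estimates

variable {V : Type*} [Fintype V] (G : SimpleGraph V) [DecidableRel G.Adj]

/-- The estimates after `p` phases. They are `0` before the first phase and `Δ + 1` after it; then,
in every phase, an estimate drops to the largest `k` such that at least `k - 2` triangles at the
edge have two other edges with estimates at least `k`. -/
def estimate : ℕ → V → V → ℕ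
  | 0 => fun _ _ => 0
  | 1 => fun v w => if G.Adj v w then G.maxDegree + 1 else 0
  | p + 2 => fun v w => Nat.findGreatest
      (fun k => k ≤ (Finset.univ.filter fun x => (G.Adj v x ∧ G.Adj w x) ∧
        k ≤ estimate (p + 1) v x ∧ k ≤ estimate (p + 1) w x).card + 2)
      (estimate (p + 1) v w)

theorem estimate_comm (p : ℕ) (v w : V) : estimate G p v w = estimate G p w v := by
  match p with
  | 0 => rfl
  | 1 => simp [estimate, G.adj_comm]
  | p + 2 =>
    have hset (k : ℕ) : (Finset.univ.filter fun x => (G.Adj v x ∧ G.Adj w x) ∧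
        k ≤ estimate G (p + 1) v x ∧ k ≤ estimate G (p + 1) w x) =
        Finset.univ.filter fun x => (G.Adj w x ∧ G.Adj v x) ∧
        k ≤ estimate G (p + 1) w x ∧ k ≤ estimate G (p + 1) v x := by
      ext x
      simp
      tauto
    simp only [estimate, hset, estimate_comm (p + 1) v w]

theorem estimate_succ_le (p : ℕ) (v w : V) :
    estimate G (p + 2) v w ≤ estimate G (p + 1) v w :=
  Nat.findGreatest_le _

variable {G}

theorem estimate_of_not_adj {v w : V} (h : ¬ G.Adj v w) (p : ℕ) : estimate G p v w = 0 := by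
  induction p using Nat.twoStepInduction with
  | zero => rfl
  | one => simp [estimate, h]
  | more p _ ih => exact Nat.le_zero.1 (ih ▸ estimate_succ_le G p v w)

theorem adj_of_estimate_ne_zero {v w : V} {p : ℕ} (h : estimate G p v w ≠ 0) : G.Adj v w := by
  by_contra hcon
  exact h (estimate_of_not_adj hcon p)

theorem estimate_le_maxDegree_add_one (p : ℕ) (v w : V) :
    estimate G p v w ≤ G.maxDegree + 1 := by
  induction p using Nat.twoStepInduction with
  | zero => exact Nat.zero_le _
  | one => simp only [estimate]; split_ifs <;> omega
  | more p _ ih => exact (estimate_succ_le G p v w).trans ih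

theorem two_le_estimate {v w : V} (h : G.Adj v w) (p : ℕ) : 2 ≤ estimate G (p + 1) v w := by
  induction p with
  | zero =>
    have h1 : 0 < G.degree v := (G.degree_pos_iff_exists_adj v).2 ⟨w, h⟩
    have h2 := G.degree_le_maxDegree v
    simp only [estimate, h, if_true]
    omega
  | succ p ih => exact Nat.le_findGreatest ih (by omega)

theorem estimate_ne_zero_iff {v w : V} {p : ℕ} : estimate G (p + 1) v w ≠ 0 ↔ G.Adj v w :=
  ⟨adj_of_estimate_ne_zero, fun h => by have := two_le_estimate h p; omega⟩

theorem estimate_two_le_support (p : ℕ) (v w : V) :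
    estimate G (p + 2) v w ≤ (Finset.univ.filter fun x => (G.Adj v x ∧ G.Adj w x) ∧
      estimate G (p + 2) v w ≤ estimate G (p + 1) v x ∧
      estimate G (p + 2) v w ≤ estimate G (p + 1) w x).card + 2 :=
  Nat.findGreatest_spec (m := 0)
    (P := fun k => k ≤ (Finset.univ.filter fun x => (G.Adj v x ∧ G.Adj w x) ∧
      k ≤ estimate G (p + 1) v x ∧ k ≤ estimate G (p + 1) w x).card + 2)
    (Nat.zero_le _) (Nat.zero_le _)

variable (G) in
/-- The edges with estimate at least `k` after `p` phases. -/
def estimateGraph (p k : ℕ) : SimpleGraph V where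
  Adj v w := G.Adj v w ∧ k ≤ estimate G p v w
  symm := ⟨fun v w h => ⟨h.1.symm, estimate_comm G p v w ▸ h.2⟩⟩
  loopless := ⟨fun _ h => h.1.ne rfl⟩

instance (p k : ℕ) : DecidableRel (estimateGraph G p k).Adj :=
  fun v w => inferInstanceAs (Decidable (G.Adj v w ∧ k ≤ estimate G p v w))

/-- An edge whose estimate is at least `k` after the next phase has support at least `k - 2` in the
graph of the edges with present estimate at least `k`. -/
theorem le_edgeSupport_estimateGraph {p k : ℕ} {v w : V} (h : G.Adj v w)
    (hk : k ≤ estimate G (p + 2) v w) :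
    k ≤ edgeSupport (estimateGraph G (p + 1) k) s(v, w) + 2 := by
  have hvw : (estimateGraph G (p + 1) k).Adj v w := ⟨h, hk.trans (estimate_succ_le G p v w)⟩
  rw [edgeSupport_eq_card _ hvw]
  refine hk.trans ((estimate_two_le_support p v w).trans ?_)
  refine Nat.add_le_add_right (Finset.card_le_card (Finset.monotone_filter_right _ ?_)) 2
  rintro x - ⟨⟨h1, h2⟩, h3, h4⟩
  exact ⟨⟨h1, hk.trans h3⟩, ⟨h2, hk.trans h4⟩⟩

theorem trussness_le_estimate {v w : V} (h : G.Adj v w) (p : ℕ) :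
    trussness G s(v, w) ≤ estimate G (p + 1) v w := by
  classical
  induction p generalizing v w with
  | zero =>
    have h1 := (mem_kTruss_iff_le_trussness G (e := s(v, w)) h _).2 le_rfl
    have h2 := (kTruss_isGreatest G _).1.2 _ h1
    have h3 := edgeSupport_mono (kTruss_isGreatest G (trussness G s(v, w))).1.1 s(v, w)
    rw [edgeSupport_eq_card G h] at h3
    have h4 : (Finset.univ.filter fun x => G.Adj v x ∧ G.Adj w x).card < G.degree v := by
      rw [← G.card_neighborFinset_eq_degree]
      refine Finset.card_lt_card ⟨fun x hx => ?_, fun hsub => ?_⟩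
      · simp only [Finset.mem_filter] at hx
        simpa using hx.2.1
      · simpa using hsub ((G.mem_neighborFinset v w).2 h)
    have h5 := G.degree_le_maxDegree v
    simp only [estimate, h, if_true]
    omega
  | succ p ih =>
    refine Nat.le_findGreatest (ih h) ?_
    have hmem : (kTruss G (trussness G s(v, w))).Adj v w :=
      (mem_kTruss_iff_le_trussness G (e := s(v, w)) h _).2 le_rfl
    have hle := (kTruss_isGreatest G (trussness G s(v, w))).1.1
    have h2 := (kTruss_isGreatest G (trussness G s(v, w))).1.2 s(v, w) hmem
    rw [edgeSupport_eq_card _ hmem] at h2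
    have hest {y x : V} (hyx : (kTruss G (trussness G s(v, w))).Adj y x) :
        trussness G s(v, w) ≤ estimate G (p + 1) y x :=
      ((mem_kTruss_iff_le_trussness G (e := s(y, x)) (hle hyx) _).1 hyx).trans (ih (hle hyx))
    refine h2.trans ?_
    refine Nat.add_le_add_right (Finset.card_le_card (Finset.monotone_filter_right _ ?_)) 2
    rintro x - ⟨h3, h4⟩
    exact ⟨⟨hle h3, hle h4⟩, hest h3, hest h4⟩

/-- As long as some estimate is too high, one of those that are too high becomes correct in the next
phase: otherwise, if `k` is the smallest trussness among the edges concerned, the edges with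
estimate above `k` would have the `(k+1)`-truss property. -/
theorem exists_estimate_eq_trussness {p : ℕ}
    (h : ∃ v w, G.Adj v w ∧ trussness G s(v, w) < estimate G (p + 1) v w) :
    ∃ v w, G.Adj v w ∧ trussness G s(v, w) < estimate G (p + 1) v w ∧
      estimate G (p + 2) v w = trussness G s(v, w) := by
  by_contra! hcon
  obtain ⟨v, w, ⟨hvw, hlt⟩, hmin⟩ : ∃ v w, (G.Adj v w ∧
      trussness G s(v, w) < estimate G (p + 1) v w) ∧ ∀ x y, G.Adj x y →
      trussness G s(x, y) < estimate G (p + 1) x y → trussness G s(v, w) ≤ trussness G s(x, y) := by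
    obtain ⟨v, w, hvw⟩ := h
    obtain ⟨⟨x, y⟩, hxy, hmin⟩ := Set.exists_min_image
      {e : V × V | G.Adj e.1 e.2 ∧ trussness G s(e.1, e.2) < estimate G (p + 1) e.1 e.2}
      (fun e => trussness G s(e.1, e.2)) (Set.toFinite _) ⟨(v, w), hvw⟩
    exact ⟨x, y, hxy, fun a b h1 h2 => hmin (a, b) ⟨h1, h2⟩⟩
  set k := trussness G s(v, w) with hk
  have hgood : estimateGraph G (p + 1) (k + 1) ≤ G := fun _ _ h => h.1
  have hprop : HasTrussProperty (k + 1) (estimateGraph G (p + 1) (k + 1)) := by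
    intro e he
    induction e using Sym2.ind with
    | _ x y =>
      obtain ⟨hxy, hle⟩ : G.Adj x y ∧ k + 1 ≤ estimate G (p + 1) x y := he
      rcases (trussness_le_estimate hxy p).eq_or_lt with heq | hlt'
      · have hmem := (mem_kTruss_iff_le_trussness G (e := s(x, y)) hxy (k + 1)).2 (heq ▸ hle)
        refine ((kTruss_isGreatest G (k + 1)).1.2 _ hmem).trans
          (Nat.add_le_add_right (edgeSupport_mono ?_ _) 2)
        intro a b hab
        have hab' := (kTruss_isGreatest G (k + 1)).1.1 hab
        exact ⟨hab', ((mem_kTruss_iff_le_trussness G (e := s(a, b)) hab' (k + 1)).1 hab).trans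
          (trussness_le_estimate hab' p)⟩
      · apply le_edgeSupport_estimateGraph hxy
        have h1 := hmin x y hxy hlt'
        have h2 : _ ≤ estimate G (p + 2) x y := trussness_le_estimate hxy (p + 1)
        have h3 := hcon x y hxy hlt'
        omega
  have hmem : (kTruss G (k + 1)).Adj v w :=
    (kTruss_isGreatest G (k + 1)).2 ⟨hgood, hprop⟩ ⟨hvw, hlt⟩
  have := (mem_kTruss_iff_le_trussness G (e := s(v, w)) hvw (k + 1)).1 hmem
  omega

/-- Once the estimates are stable they are the trussness values. -/
theorem estimate_eq_trussness {p : ℕ} (h : estimate G (p + 2) = estimate G (p + 1)) {v w : V}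
    (hvw : G.Adj v w) : estimate G (p + 1) v w = trussness G s(v, w) := by
  refine le_antisymm ?_ (trussness_le_estimate hvw p)
  by_contra! hlt
  obtain ⟨x, y, -, h1, h2⟩ := exists_estimate_eq_trussness ⟨v, w, hvw, hlt⟩
  rw [h] at h2
  omega

theorem card_adj_eq_twice_card_edges :
    (Finset.univ.filter fun e : V × V => G.Adj e.1 e.2).card = 2 * G.edgeFinset.card := by
  rw [← G.sum_degrees_eq_twice_card_edges, Finset.card_filter, Fintype.sum_prod_type]
  refine Finset.sum_congr rfl fun v _ => ?_
  rw [← Finset.card_filter, ← G.card_neighborFinset_eq_degree, G.neighborFinset_eq_filter]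

/-- Every phase corrects an estimate, so the estimates are stable after `2m + 1` phases (both
orientations of an edge are counted). -/
theorem exists_estimate_stable :
    ∃ q ≤ 2 * G.edgeFinset.card + 1, estimate G (q + 1) = estimate G q := by
  by_contra! hcon
  let U (p : ℕ) : Finset (V × V) := Finset.univ.filter fun e =>
    G.Adj e.1 e.2 ∧ trussness G s(e.1, e.2) < estimate G (p + 1) e.1 e.2
  have hU (p : ℕ) (hp : p ≤ 2 * G.edgeFinset.card) : (U p).Nonempty := by
    by_contra hempty
    rw [Finset.not_nonempty_iff_eq_empty] at hempty
    apply hcon (p + 1) (by omega)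
    ext v w
    by_cases hvw : G.Adj v w
    · have h1 := trussness_le_estimate hvw p
      have h2 := trussness_le_estimate hvw (p + 1)
      have h3 := estimate_succ_le G p v w
      have h4 : (v, w) ∉ U p := by simp [hempty]
      simp only [U, Finset.mem_filter, Finset.mem_univ, true_and, hvw, not_lt] at h4
      change estimate G (p + 2) v w = _
      change _ ≤ estimate G (p + 2) v w at h2
      omega
    · rw [estimate_of_not_adj hvw, estimate_of_not_adj hvw]
  have hlt (p : ℕ) (hp : p ≤ 2 * G.edgeFinset.card) : (U (p + 1)).card < (U p).card := by
    obtain ⟨⟨x, y⟩, hxy⟩ := hU p hp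
    simp only [U, Finset.mem_filter, Finset.mem_univ, true_and] at hxy
    obtain ⟨v, w, hvw, h1, h2⟩ := exists_estimate_eq_trussness ⟨x, y, hxy⟩
    refine Finset.card_lt_card ⟨fun e he => ?_, fun hsub => ?_⟩
    · simp only [U, Finset.mem_filter, Finset.mem_univ, true_and] at he ⊢
      exact ⟨he.1, he.2.trans_le (estimate_succ_le G p _ _)⟩
    · have := hsub (show (v, w) ∈ U p by simp [U, hvw, h1])
      simp only [U, Finset.mem_filter, Finset.mem_univ, true_and] at this
      exact this.2.ne' h2
  have hcard (p : ℕ) (hp : p ≤ 2 * G.edgeFinset.card + 1) :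
      (U p).card + p ≤ 2 * G.edgeFinset.card := by
    induction p with
    | zero =>
      rw [← card_adj_eq_twice_card_edges]
      exact Finset.card_le_card fun e he => by
        simp only [U, Finset.mem_filter, Finset.mem_univ, true_and] at he ⊢
        exact he.1
    | succ p ih =>
      have := hlt p (by omega)
      have := ih (by omega)
      omega
  have := hcard (2 * G.edgeFinset.card + 1) le_rfl
  omega

/-! ### Termination detection -/

variable (G) in
/-- The alarm of the agent from `v` after `p` phases. -/
noncomputable def alarmLevel : ℕ → V → ℕ
  | 0 => fun _ => G.diam + 1
  | p + 1 => fun v =>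
      if estimate G (p + 1) v = estimate G p v then
        (alarmLevel p v ⊔ (G.neighborFinset v).sup (alarmLevel p)) - 1
      else G.diam + 1

theorem alarmLevel_succ (p : ℕ) (v : V) : alarmLevel G (p + 1) v =
    if estimate G (p + 1) v = estimate G p v then
      (alarmLevel G p v ⊔ (G.neighborFinset v).sup (alarmLevel G p)) - 1
    else G.diam + 1 :=
  rfl

theorem alarmLevel_le (p : ℕ) (v : V) : alarmLevel G p v ≤ G.diam + 1 := by
  induction p generalizing v with
  | zero => exact le_rfl
  | succ p ih =>
    rw [alarmLevel_succ]
    split_ifs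
    · exact (Nat.sub_le _ _).trans (sup_le (ih v) (Finset.sup_le fun w _ => ih w))
    · exact le_rfl

theorem le_alarmLevel_succ (p : ℕ) {u v : V} (h : u = v ∨ G.Adj v u) :
    alarmLevel G p u ≤ alarmLevel G (p + 1) v + 1 := by
  have h1 := alarmLevel_le (G := G) p u
  have h2 : alarmLevel G p u ≤ alarmLevel G p v ⊔ (G.neighborFinset v).sup (alarmLevel G p) := by
    rcases h with rfl | h
    · exact le_sup_left
    · exact le_sup_of_le_right (Finset.le_sup (f := alarmLevel G p) (by simpa using h))
  rw [alarmLevel_succ]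
  split_ifs <;> omega

theorem le_alarmLevel_add (p j : ℕ) (v : V) :
    alarmLevel G p v ≤ alarmLevel G (p + j) v + j := by
  induction j with
  | zero => exact le_rfl
  | succ j ih =>
    have : _ ≤ alarmLevel G (p + (j + 1)) v + 1 :=
      le_alarmLevel_succ (p + j) (Or.inl (Eq.refl v))
    omega

theorem le_alarmLevel_add_length (p : ℕ) {u v : V} (c : G.Walk v u) :
    alarmLevel G p u ≤ alarmLevel G (p + c.length) v + c.length := by
  induction c with
  | nil => exact le_rfl
  | cons h c ih =>
    rw [SimpleGraph.Walk.length_cons]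
    have := ih.trans (Nat.add_le_add_right (le_alarmLevel_succ (p + c.length) (Or.inr h)) _)
    rw [← add_assoc p]
    omega

/-- A change reaches every agent before the alarm that it sets off has run out. -/
theorem alarmLevel_pos (hG : G.Connected) {F : ℕ}
    (hF : ∀ q < F, estimate G (q + 1) ≠ estimate G q) {p : ℕ} (hp : p ≤ F + G.diam) (v : V) :
    0 < alarmLevel G p v := by
  have : Nonempty V := ⟨v⟩
  rcases le_or_gt p G.diam with hpD | hpD
  · have := le_alarmLevel_add (G := G) 0 p v
    simp only [alarmLevel, zero_add] at this
    omega
  · obtain ⟨q, rfl⟩ := Nat.exists_eq_add_of_lt hpD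
    obtain ⟨u, hu⟩ := Function.ne_iff.1 (hF q (by omega))
    have hu' : alarmLevel G (q + 1) u = G.diam + 1 := by rw [alarmLevel_succ, if_neg hu]
    obtain ⟨c, hc⟩ := hG.exists_walk_length_eq_dist v u
    have hd : G.dist v u ≤ G.diam :=
      SimpleGraph.dist_le_diam (SimpleGraph.connected_iff_ediam_ne_top.1 hG)
    have h1 := le_alarmLevel_add_length (q + 1) c
    have h2 := le_alarmLevel_add (G := G) (q + 1 + c.length) (G.diam - c.length) v
    rw [show q + 1 + c.length + (G.diam - c.length) = G.diam + q + 1 by omega] at h2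
    omega

theorem estimate_add_of_stable {F : ℕ} (hF : estimate G (F + 1) = estimate G F) (j : ℕ) :
    estimate G (F + j) = estimate G F := by
  have hstep {p : ℕ} (h : estimate G (p + 1) = estimate G p) :
      estimate G (p + 2) = estimate G (p + 1) := by
    match p with
    | 0 =>
      have hno (v w : V) : ¬ G.Adj v w := fun hvw => by
        have := two_le_estimate hvw 0
        rw [h] at this
        simp [estimate] at this
      ext v w
      rw [estimate_of_not_adj (hno v w), estimate_of_not_adj (hno v w)]
    | p + 1 =>
      ext v w
      change Nat.findGreatest _ _ = Nat.findGreatest _ _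
      rw [h]
  have hall (j : ℕ) : estimate G (F + j + 1) = estimate G (F + j) := by
    induction j with
    | zero => exact hF
    | succ j ih => exact hstep ih
  induction j with
  | zero => rfl
  | succ j ih => exact (hall j).trans ih

theorem alarmLevel_eq_zero {F : ℕ} (hF : estimate G (F + 1) = estimate G F) (v : V) :
    alarmLevel G (F + G.diam + 1) v = 0 := by
  have h (j : ℕ) : ∀ v, alarmLevel G (F + j) v ≤ G.diam + 1 - j := by
    induction j with
    | zero => exact alarmLevel_le F
    | succ j ih =>
      intro v
      have heq : estimate G (F + j + 1) v = estimate G (F + j) v := by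
        rw [estimate_add_of_stable hF j, add_assoc, estimate_add_of_stable hF (j + 1)]
      rw [← add_assoc, alarmLevel_succ, if_pos heq]
      have := sup_le (ih v) (Finset.sup_le fun w (_ : w ∈ G.neighborFinset v) => ih w)
      omega
  have := h (G.diam + 1) v
  rw [← add_assoc] at this
  omega

end Estimates

/-! ### Tables -/

section Tables

variable {V : Type*} [Fintype V]

/-- The table of an agent at whose home the edge to `w` has estimate `f w` (`0` if there is no edge
or no estimate). -/
def edgeTable (ids : V → ℕ) (f : V → ℕ) : Finset (ℕ × ℕ) :=
  (Finset.univ.filter fun w => f w ≠ 0).image fun w => (ids w, f w)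

theorem card_edgeTable_le {ids : V → ℕ} {f : V → ℕ} {d : ℕ}
    (h : (Finset.univ.filter fun w => f w ≠ 0).card ≤ d) : (edgeTable ids f).card ≤ d :=
  Finset.card_image_le.trans h

theorem mem_edgeTable {ids : V → ℕ} {f : V → ℕ} {x : ℕ × ℕ} :
    x ∈ edgeTable ids f ↔ ∃ w, f w ≠ 0 ∧ (ids w, f w) = x := by
  simp [edgeTable]

variable {ids : V → ℕ}

theorem lookup_edgeTable (hids : Function.Injective ids) (f : V → ℕ) (w : V) :
    lookup (edgeTable ids f) (ids w) = f w := by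
  refine le_antisymm (Finset.sup_le fun x hx => ?_) ?_
  · obtain ⟨hx, hxw⟩ := Finset.mem_filter.1 hx
    obtain ⟨u, -, rfl⟩ := mem_edgeTable.1 hx
    rw [hids hxw]
  · by_cases h : f w = 0
    · omega
    · exact Finset.le_sup (f := Prod.snd) (b := (ids w, f w))
        (Finset.mem_filter.2 ⟨mem_edgeTable.2 ⟨w, h, rfl⟩, rfl⟩)

theorem edgeTable_injective (hids : Function.Injective ids) :
    Function.Injective (edgeTable (V := V) ids) := fun f g h => by
  ext w
  rw [← lookup_edgeTable hids f, h, lookup_edgeTable hids]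

theorem lookup_edgeTable_eq_iff (hids : Function.Injective ids) (f : V → ℕ) {j k : ℕ}
    (hk : k ≠ 0) :
    lookup (edgeTable ids f) j = k ↔ ∃ w, ids w = j ∧ f w = k := by
  constructor
  · intro h
    by_cases hj : ∃ w, ids w = j
    · obtain ⟨w, rfl⟩ := hj
      exact ⟨w, rfl, by rw [← h, lookup_edgeTable hids]⟩
    · have : (edgeTable ids f).filter (fun x => x.1 = j) = ∅ := by
        refine Finset.filter_eq_empty_iff.2 fun x hx hxj => ?_
        obtain ⟨w, -, rfl⟩ := mem_edgeTable.1 hx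
        exact hj ⟨w, hxj⟩
      rw [lookup, this, Finset.sup_empty] at h
      exact absurd h.symm hk
  · rintro ⟨w, rfl, rfl⟩
    exact lookup_edgeTable hids f w

theorem refineTable_edgeTable (hids : Function.Injective ids) {G : SimpleGraph V}
    [DecidableRel G.Adj] (p : ℕ) {v u : V}
    (h : G.Adj v u) :
    refineTable G.maxDegree (edgeTable ids (estimate G p v)) (edgeTable ids (estimate G p u))
      (ids u) = estimate G (p + 1) v u := by
  classical
  rw [refineTable, lookup_edgeTable hids]
  match p with
  | 0 => simp [estimate, h]
  | p + 1 =>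
    rw [if_neg (estimate_ne_zero_iff.2 h)]
    have himg (v : V) : (edgeTable ids (estimate G (p + 1) v)).image Prod.fst =
        (Finset.univ.filter fun x => G.Adj v x).image ids := by
      simp only [edgeTable, Finset.image_image, estimate_ne_zero_iff]
      rfl
    have hcard (k : ℕ) :
        (((edgeTable ids (estimate G (p + 1) v)).image Prod.fst ∩
          (edgeTable ids (estimate G (p + 1) u)).image Prod.fst).filter fun i =>
            k ≤ lookup (edgeTable ids (estimate G (p + 1) v)) i ∧
            k ≤ lookup (edgeTable ids (estimate G (p + 1) u)) i).card =
        (Finset.univ.filter fun x => (G.Adj v x ∧ G.Adj u x) ∧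
          k ≤ estimate G (p + 1) v x ∧ k ≤ estimate G (p + 1) u x).card := by
      rw [himg, himg, ← Finset.image_inter _ _ hids, Finset.filter_image,
        Finset.card_image_of_injective _ hids, ← Finset.filter_and, Finset.filter_filter]
      simp only [lookup_edgeTable hids]
    simp only [hcard]
    rfl

end Tables

/-! ### Execution of the algorithm -/

section Execution

variable {V : Type*} [Fintype V] {G : SimpleGraph V} [DecidableRel G.Adj]
  (ports : PortNumbering G) (ids : V → ℕ)

theorem moveAgent_mem (v : V) (mem : List Bool) (p : Option ℕ) :
    (moveAgent G ports v mem p).mem = mem := by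
  unfold moveAgent
  split
  · rfl
  · split_ifs <;> rfl

theorem moveAgent_pos (v : V) (mem mem' : List Bool) (p : Option ℕ) :
    (moveAgent G ports v mem p).pos = (moveAgent G ports v mem' p).pos := by
  unfold moveAgent
  split
  · rfl
  · split_ifs <;> rfl

theorem moveAgent_pos_some {v u : V} (h : G.Adj v u) (mem : List Bool) :
    (moveAgent G ports v mem (some (ports v ⟨u, h⟩ : ℕ))).pos = u := by
  simp [moveAgent]

/-- An agent that has just moved knows the way back from its entry port. -/
theorem moveAgent_spec (v : V) (mem : List Bool) (p : Option ℕ) :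
    moveAgent G ports v mem p = ⟨v, mem, none⟩ ∨
      ∃ (w : V) (h : G.Adj w v), moveAgent G ports v mem p =
        ⟨w, mem, some (ports w ⟨v, h⟩ : ℕ)⟩ := by
  unfold moveAgent
  split
  · exact Or.inl rfl
  · split_ifs with h
    · exact Or.inr ⟨_, SimpleGraph.Adj.symm ((ports v).symm ⟨_, h⟩).2, rfl⟩
    · exact Or.inl rfl

theorem moveAgent_entry_eq_none_iff (v : V) (mem : List Bool) (p : Option ℕ) :
    (moveAgent G ports v mem p).entry = none ↔ (moveAgent G ports v mem p).pos = v := by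
  rcases moveAgent_spec ports v mem p with h | ⟨w, hw, h⟩
  · simp [h]
  · simp [h, hw.ne]

theorem moveAgent_back (v : V) (mem mem' : List Bool) (p : Option ℕ) :
    (moveAgent G ports (moveAgent G ports v mem p).pos mem'
      (moveAgent G ports v mem p).entry).pos = v := by
  rcases moveAgent_spec ports v mem p with h | ⟨w, hw, h⟩
  · rw [h]
    rfl
  · rw [h, moveAgent_pos_some]

/-- The port through which the agent from `v` leaves in slot `s`, if it does. -/
def slotPort (s : ℕ) (v : V) : Option ℕ :=
  if isMover G.maxDegree s (ids v) then some (s % G.maxDegree) else none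

/-- The position of the agent from `v` in the middle of slot `s`. -/
def slotPos (s : ℕ) (v : V) : V := (moveAgent G ports v [] (slotPort (G := G) ids s v)).pos

theorem adj_of_slotPos {s : ℕ} {v u : V} (h : slotPos ports ids s u = v) (hne : u ≠ v) :
    G.Adj v u := by
  rw [slotPos] at h
  rcases moveAgent_spec ports u [] (slotPort (G := G) ids s u) with h' | ⟨w, hw, h'⟩
  · rw [h'] at h
    exact absurd h hne
  · rw [h'] at h
    exact h ▸ hw

/-- The number of rounds of a phase. -/
noncomputable def phaseLength (G : SimpleGraph V) [DecidableRel G.Adj] (ids : V → ℕ) : ℕ :=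
  2 * (2 * G.maxDegree * (highestID ids).size)

theorem phaseLength_pos (hΔ : G.maxDegree ≠ 0) (hlam : 1 < highestID ids) :
    0 < phaseLength G ids := by
  have : 0 < (highestID ids).size := Nat.size_pos.2 (by omega)
  unfold phaseLength
  positivity

variable [DecidableEq V]

/-- The visitors whom the agent from `v` meets at home in slot `s`. -/
def visitors (s : ℕ) (v : V) : Finset V :=
  if slotPos ports ids s v = v then Finset.univ.filter fun u => u ≠ v ∧ slotPos ports ids s u = v
  else ∅

/-- The visitors whom the agent from `v` meets at home in the first `s` slots of a phase. -/
def seen (s : ℕ) (v : V) : Finset V := (Finset.range s).biUnion fun i => visitors ports ids i v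

theorem seen_succ (s : ℕ) (v : V) :
    seen ports ids (s + 1) v = seen ports ids s v ∪ visitors ports ids s v := by
  rw [seen, Finset.range_add_one, Finset.biUnion_insert, Finset.union_comm]
  rfl

theorem adj_of_mem_visitors {s : ℕ} {v u : V} (h : u ∈ visitors ports ids s v) : G.Adj v u := by
  rw [visitors] at h
  split_ifs at h
  · obtain ⟨hne, hu⟩ := (Finset.mem_filter.1 h).2
    exact adj_of_slotPos ports ids hu hne
  · simp at h

theorem seen_subset (s : ℕ) (v : V) : seen ports ids s v ⊆ G.neighborFinset v := by
  intro u hu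
  obtain ⟨i, -, hi⟩ := Finset.mem_biUnion.1 hu
  exact (G.mem_neighborFinset v u).2 (adj_of_mem_visitors ports ids hi)

/-- In every phase an agent meets all its neighbours at home: the IDs of two neighbours differ at
some bit position, and there is a slot in which one of them leaves for the other one's home while
the other one stays. -/
theorem seen_all (hids : Function.Injective ids) (v : V) :
    seen ports ids (2 * G.maxDegree * (highestID ids).size) v = G.neighborFinset v := by
  refine (seen_subset ports ids _ v).antisymm fun u hu => ?_
  have huv : G.Adj u v := ((G.mem_neighborFinset v u).1 hu).symm
  obtain ⟨i, hi, hdiff⟩ :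
      ∃ i < (highestID ids).size, (ids u).testBit i ≠ (ids v).testBit i := by
    by_contra! hcon
    refine huv.ne (hids (Nat.eq_of_testBit_eq fun i => ?_))
    rcases lt_or_ge i (highestID ids).size with hi | hi
    · exact hcon i hi
    · have hbit (w : V) : (ids w).testBit i = false :=
        Nat.testBit_lt_two_pow ((Finset.le_sup (f := ids) (Finset.mem_univ w)).trans_lt
          ((Nat.lt_size_self _).trans_le (Nat.pow_le_pow_right (by norm_num) hi)))
      rw [hbit, hbit]
  -- The slot for the port from `u` to `v`, the position `i` and the bit of `u` there.
  set q : ℕ := (ports u ⟨v, huv⟩ : ℕ) with hq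
  have hqΔ : q < G.maxDegree := (ports u ⟨v, huv⟩).2.trans_le (G.degree_le_maxDegree u)
  set b : ℕ := if (ids u).testBit i then 1 else 0 with hb
  have hb2 : b < 2 := by rw [hb]; split_ifs <;> omega
  set s := G.maxDegree * (2 * i + b) + q with hs
  have hs1 : s % G.maxDegree = q := by rw [hs, Nat.mul_add_mod, Nat.mod_eq_of_lt hqΔ]
  have hs2 : s / G.maxDegree = 2 * i + b := by
    rw [hs, Nat.mul_add_div (by omega), Nat.div_eq_of_lt hqΔ, add_zero]
  have hmov (w : V) : isMover G.maxDegree s (ids w) =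
      ((ids w).testBit i == (ids u).testBit i) := by
    rw [isMover, hs2, show (2 * i + b) / 2 = i by omega, show (2 * i + b) % 2 = b by omega, hb]
    cases (ids u).testBit i <;> rfl
  have hsu : slotPos ports ids s u = v := by
    rw [slotPos, slotPort, hmov, beq_self_eq_true, if_pos rfl, hs1, hq, moveAgent_pos_some]
  have hsv : slotPos ports ids s v = v := by
    rw [slotPos, slotPort, hmov, beq_eq_false_iff_ne.2 hdiff.symm]
    rfl
  refine Finset.mem_biUnion.2 ⟨s, Finset.mem_range.2 ?_, ?_⟩
  · calc s < G.maxDegree * (2 * i + b) + G.maxDegree := by omega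
      _ = G.maxDegree * (2 * i + b + 1) := by ring
      _ ≤ G.maxDegree * (2 * (highestID ids).size) := Nat.mul_le_mul_left _ (by omega)
      _ = 2 * G.maxDegree * (highestID ids).size := by ring
  · rw [visitors, if_pos hsv]
    simp [hsu, huv.ne]

/-- The memory of the agent from `v` when `c` rounds have passed since the end of phase `p`. -/
noncomputable def memAt (p c : ℕ) (v : V) : AgentMemory where
  maxDeg := G.maxDegree
  diam := G.diam
  lam := highestID ids
  ownID := ids v
  clock := c
  alarm := alarmLevel G p v
  heard := (seen ports ids (c / 2) v).sup (alarmLevel G p)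
  table := edgeTable ids (estimate G p v)
  draft := (seen ports ids (c / 2) v).image fun u => (ids u, estimate G (p + 1) v u)

open AgentMemory

theorem tick_memAt_even (p s : ℕ) (v : V) :
    (memAt ports ids p (2 * s) v).tick = memAt ports ids p (2 * s + 1) v := by
  have h : (memAt ports ids p (2 * s) v).clock + 1 ≠
      2 * (memAt ports ids p (2 * s) v).slots := by
    change 2 * s + 1 ≠ _
    omega
  rw [tick, if_neg h]
  simp only [memAt]
  rw [show 2 * s / 2 = s by omega, show (2 * s + 1) / 2 = s by omega]

/-- The memory after the second round of slot `s`, before the clock advances. -/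
theorem learn_memAt (hids : Function.Injective ids) (p s : ℕ) (v : V)
    (h : slotPos ports ids s v = v) :
    (memAt ports ids p (2 * s + 1) v).learn
      ((Finset.univ.filter fun u => u ≠ v ∧ slotPos ports ids s u = v).val.map
        fun u => memAt ports ids p (2 * s + 1) u) =
      { memAt ports ids p (2 * s + 2) v with clock := 2 * s + 1 } := by
  have hvis : (Finset.univ.filter fun u => u ≠ v ∧ slotPos ports ids s u = v) =
      visitors ports ids s v := by rw [visitors, if_pos h]
  rw [hvis]
  simp only [learn, memAt, Multiset.map_map, Function.comp_def]
  rw [show (2 * s + 2) / 2 = s + 1 by omega, show (2 * s + 1) / 2 = s by omega, seen_succ,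
    Finset.sup_union, Finset.image_union]
  congr 2
  rw [← Finset.image_toFinset]
  simp only [Finset.val_toFinset]
  refine Finset.image_congr fun u hu => ?_
  simp only [refineTable_edgeTable hids p (adj_of_mem_visitors ports ids hu)]

theorem memAt_of_away (p s : ℕ) (v : V) (h : slotPos ports ids s v ≠ v) :
    memAt ports ids p (2 * s + 1) v =
      { memAt ports ids p (2 * s + 2) v with clock := 2 * s + 1 } := by
  simp only [memAt]
  rw [show (2 * s + 2) / 2 = s + 1 by omega, show (2 * s + 1) / 2 = s by omega, seen_succ,
    visitors, if_neg h, Finset.union_empty]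

theorem tick_of_lt (p s : ℕ) (v : V) (h : 2 * s + 2 ≠ phaseLength G ids) :
    { memAt ports ids p (2 * s + 2) v with clock := 2 * s + 1 }.tick =
      memAt ports ids p (2 * s + 2) v := by
  rw [tick, if_neg]
  · simp only [memAt]
  · exact h

theorem tick_of_eq (hids : Function.Injective ids) (p s : ℕ) (v : V)
    (h : 2 * s + 2 = phaseLength G ids) :
    { memAt ports ids p (2 * s + 2) v with clock := 2 * s + 1 }.tick =
      memAt ports ids (p + 1) 0 v := by
  have hs : (2 * s + 2) / 2 = 2 * G.maxDegree * (highestID ids).size := by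
    rw [h, phaseLength]
    omega
  have hdraft : (G.neighborFinset v).image (fun u => (ids u, estimate G (p + 1) v u)) =
      edgeTable ids (estimate G (p + 1) v) := by
    simp only [edgeTable, estimate_ne_zero_iff, G.neighborFinset_eq_filter]
  rw [tick, if_pos]
  · simp only [memAt, hs, seen_all ports ids hids, hdraft, (edgeTable_injective hids).eq_iff]
    simp [seen, alarmLevel_succ]
  · exact h

/-- All agents are at home with the memories of round `c` after phase `p`. -/
def AtHome (σ : V → AgentState V) (p c : ℕ) : Prop :=
  ∀ v, (σ v).pos = v ∧ (σ v).mem = (memAt ports ids p c v).code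

theorem halted_code (m : AgentMemory) : trussAlgorithm.halted m.code = decide (m.alarm = 0) := by
  simp [trussAlgorithm]

/-- The movers leave. -/
theorem agentRound_even {σ : V → AgentState V} {p s : ℕ} (hσ : AtHome ports ids σ p (2 * s))
    (hp : ∀ v, 0 < alarmLevel G p v) (v : V) :
    agentRound G trussAlgorithm ports σ v =
      moveAgent G ports v (memAt ports ids p (2 * s + 1) v).code (slotPort (G := G) ids s v) := by
  have h : trussAlgorithm.halted (σ v).mem = false := by
    rw [(hσ v).2, halted_code]
    exact decide_eq_false (hp v).ne'
  have hm : (memAt ports ids p (2 * s) v).clock = 2 * s := rfl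
  rw [agentRound, if_neg (ne_true_of_eq_false h)]
  simp only [trussAlgorithm, (hσ v).1, (hσ v).2,
    decode_code, tick_memAt_even, hm, Nat.mul_mod_right, if_true,
    Nat.mul_div_cancel_left s two_pos]
  rfl

/-- The movers return, and the agents at home learn from them. -/
theorem agentRound_odd (hids : Function.Injective ids) {σ : V → AgentState V} {p s : ℕ}
    (hσ : AtHome ports ids σ p (2 * s)) (hp : ∀ v, 0 < alarmLevel G p v) (v : V) :
    (agentRound G trussAlgorithm ports (agentRound G trussAlgorithm ports σ) v).pos = v ∧
    (agentRound G trussAlgorithm ports (agentRound G trussAlgorithm ports σ) v).mem =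
      { memAt ports ids p (2 * s + 2) v with clock := 2 * s + 1 }.tick.code := by
  have hround := agentRound_even ports ids hσ hp
  set σ' := agentRound G trussAlgorithm ports σ
  have hmem (u : V) : (σ' u).mem = (memAt ports ids p (2 * s + 1) u).code := by
    rw [hround, moveAgent_mem]
  have hpos (u : V) : (σ' u).pos = slotPos ports ids s u := by
    rw [hround, slotPos]
    exact moveAgent_pos ..
  have hentry : (σ' v).entry = none ↔ slotPos ports ids s v = v := by
    rw [← hpos, hround]
    exact moveAgent_entry_eq_none_iff ..
  have h : trussAlgorithm.halted (σ' v).mem = false := by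
    rw [hmem, halted_code]
    exact decide_eq_false (hp v).ne'
  have hclock : (memAt ports ids p (2 * s + 1) v).clock % 2 = 1 := by
    change (2 * s + 1) % 2 = 1
    omega
  rw [agentRound, if_neg (ne_true_of_eq_false h)]
  simp only [trussAlgorithm, hmem, decode_code, hclock,
    one_ne_zero, if_false, Multiset.map_map, Function.comp_def, hpos v]
  constructor
  · rw [← hpos, hround]
    exact moveAgent_back ..
  · rw [moveAgent_mem]
    by_cases hv : slotPos ports ids s v = v
    · rw [if_pos (hentry.2 hv)]
      simp only [hpos, hv]
      rw [learn_memAt ports ids hids p s v hv]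
    · rw [if_neg (mt hentry.1 hv), memAt_of_away ports ids p s v hv]

theorem agentRun_succ (A : AgentAlgorithm) (t : ℕ) :
    agentRun G A ports ids (t + 1) = agentRound G A ports (agentRun G A ports ids t) := rfl

theorem atHome_initial (hΔ : G.maxDegree ≠ 0) (hlam : 1 < highestID ids) :
    AtHome ports ids (agentRun G trussAlgorithm ports ids 0) 0 0 := by
  intro v
  simp [agentRun, trussAlgorithm, hΔ, initial, hlam.not_ge, memAt, seen, edgeTable, estimate,
    alarmLevel]

/-- The situation within a phase, and at the end of the last of its slots. -/
theorem atHome_phase (hids : Function.Injective ids) {t p : ℕ}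
    (h0 : AtHome ports ids (agentRun G trussAlgorithm ports ids t) p 0)
    (hp : ∀ v, 0 < alarmLevel G p v) (s : ℕ) (hs : 2 * s < phaseLength G ids) :
    AtHome ports ids (agentRun G trussAlgorithm ports ids (t + 2 * s)) p (2 * s) ∧
      (2 * s + 2 = phaseLength G ids →
        AtHome ports ids (agentRun G trussAlgorithm ports ids (t + 2 * s + 2)) (p + 1) 0) := by
  have hnext (s : ℕ) (h : AtHome ports ids (agentRun G trussAlgorithm ports ids (t + 2 * s)) p
      (2 * s)) := agentRound_odd ports ids hids h hp
  have hstart : AtHome ports ids (agentRun G trussAlgorithm ports ids (t + 2 * s)) p (2 * s) := by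
    induction s with
    | zero => exact h0
    | succ s ih =>
      intro v
      have := hnext s (ih (by omega)) v
      rwa [tick_of_lt ports ids p s v (by omega)] at this
  refine ⟨hstart, fun hlast v => ?_⟩
  have := hnext s hstart v
  rwa [tick_of_eq ports ids hids p s v hlast] at this

theorem atHome_phase_start (hids : Function.Injective ids) (hΔ : G.maxDegree ≠ 0)
    (hlam : 1 < highestID ids) (p : ℕ) (hp : ∀ q < p, ∀ v, 0 < alarmLevel G q v) :
    AtHome ports ids (agentRun G trussAlgorithm ports ids (phaseLength G ids * p)) p 0 := by
  induction p with
  | zero => exact atHome_initial ports ids hΔ hlam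
  | succ p ih =>
    have hpos := phaseLength_pos ids hΔ hlam
    set s := 2 * G.maxDegree * (highestID ids).size - 1 with hs
    have hlen : 2 * s + 2 = phaseLength G ids := by
      unfold phaseLength at hpos ⊢
      omega
    have := (atHome_phase ports ids hids (ih fun q hq => hp q (by omega)) (hp p (by omega)) s
      (by omega)).2 hlen
    rwa [add_assoc, hlen, ← Nat.mul_succ] at this

/-- Terminated agents keep their memory. -/
theorem agentRun_mem_of_halted (A : AgentAlgorithm) {T : ℕ}
    (hT : ∀ v, A.halted (agentRun G A ports ids T v).mem = true) (j : ℕ) (v : V) :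
    (agentRun G A ports ids (T + j) v).mem = (agentRun G A ports ids T v).mem := by
  induction j with
  | zero => rfl
  | succ j ih =>
    have h : A.halted (agentRun G A ports ids (T + j) v).mem = true := by rw [ih, hT]
    rw [← add_assoc, agentRun_succ, agentRound, if_pos h]
    exact ih

/-- At all times the memory of an agent is one of those described by `memAt`. -/
theorem exists_agentRun_mem_eq (hids : Function.Injective ids) (hΔ : G.maxDegree ≠ 0)
    (hlam : 1 < highestID ids) {P : ℕ} (hpos : ∀ q < P, ∀ v, 0 < alarmLevel G q v)
    (hzero : ∀ v, alarmLevel G P v = 0) (t : ℕ) (v : V) :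
    ∃ p, ∃ c < phaseLength G ids,
      (agentRun G trussAlgorithm ports ids t v).mem = (memAt ports ids p c v).code := by
  have hlen := phaseLength_pos (G := G) ids hΔ hlam
  rcases lt_or_ge t (phaseLength G ids * P) with ht | ht
  · set p := t / phaseLength G ids
    set c := t % phaseLength G ids
    have hc : c < phaseLength G ids := Nat.mod_lt _ hlen
    have hp : p < P := Nat.div_lt_of_lt_mul ht
    have htpc : t = phaseLength G ids * p + c := (Nat.div_add_mod _ _).symm
    have hstart := (atHome_phase ports ids hids
      (atHome_phase_start ports ids hids hΔ hlam p fun q hq => hpos q (hq.trans hp))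
      (hpos p hp) (c / 2) (by omega)).1
    refine ⟨p, c, hc, ?_⟩
    rcases Nat.even_or_odd' c with ⟨s, hs | hs⟩
    · rw [show c / 2 = s by omega, ← hs, ← htpc] at hstart
      exact (hstart v).2
    · rw [show c / 2 = s by omega] at hstart
      rw [htpc, hs, ← add_assoc, agentRun_succ, agentRound_even ports ids hstart (hpos p hp),
        moveAgent_mem]
  · obtain ⟨j, rfl⟩ := Nat.exists_eq_add_of_le ht
    have hend := atHome_phase_start ports ids hids hΔ hlam P hpos
    refine ⟨P, 0, hlen, ?_⟩
    rw [agentRun_mem_of_halted ports ids _ (fun w => ?_) j v, (hend v).2]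
    rw [(hend w).2, halted_code]
    exact decide_eq_true (hzero w)

theorem output_code_eq_some_iff (m : AgentMemory) (j k : ℕ) :
    trussAlgorithm.output m.code j = some k ↔ k ≠ 0 ∧ lookup m.table j = k := by
  simp only [trussAlgorithm, decode_code]
  split_ifs with h
  · simp only [h, false_iff]
    rintro ⟨h1, rfl⟩
    exact h1 rfl
  · simp only [Option.some.injEq]
    exact ⟨fun hk => ⟨hk ▸ h, hk⟩, fun hk => hk.2⟩

theorem solvesTrussDecomposition_of_stable (hids : Function.Injective ids)
    (hΔ : G.maxDegree ≠ 0) (hlam : 1 < highestID ids) {F : ℕ}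
    (hpos : ∀ q < F + G.diam + 1, ∀ v, 0 < alarmLevel G q v)
    (hF : estimate G (F + 1) = estimate G F) :
    SolvesTrussDecomposition G trussAlgorithm ports ids
      (phaseLength G ids * (F + G.diam + 1)) := by
  intro v
  rw [(atHome_phase_start ports ids hids hΔ hlam _ hpos v).2, halted_code]
  refine ⟨decide_eq_true (alarmLevel_eq_zero hF v), fun j k => ?_⟩
  have htruss {w : V} (h : G.Adj v w) :
      estimate G (F + G.diam + 1) v w = trussness G s(v, w) := by
    refine estimate_eq_trussness ?_ h
    rw [add_assoc, add_assoc, estimate_add_of_stable hF, estimate_add_of_stable hF]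
  rw [output_code_eq_some_iff]
  constructor
  · rintro ⟨hk, h⟩
    obtain ⟨w, hw, rfl⟩ := (lookup_edgeTable_eq_iff hids _ hk).1 h
    exact ⟨w, adj_of_estimate_ne_zero hk, hw, (htruss (adj_of_estimate_ne_zero hk)).symm⟩
  · rintro ⟨w, hw, hj, rfl⟩
    have hk := estimate_ne_zero_iff (p := F + G.diam).2 hw
    rw [htruss hw] at hk
    exact ⟨hk, (lookup_edgeTable_eq_iff hids _ hk).2 ⟨w, hj, htruss hw⟩⟩

end Execution

/-! ### Bounds -/

section Bounds

variable {V : Type*} [Fintype V] {G : SimpleGraph V} [DecidableRel G.Adj] {ids : V → ℕ}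

theorem card_le_highestID_add_one (hids : Function.Injective ids) :
    Fintype.card V ≤ highestID ids + 1 := by
  rw [← Finset.card_range (highestID ids + 1), ← Finset.card_univ]
  exact Finset.card_le_card_of_injOn ids
    (fun v _ => Finset.mem_coe.2 (Finset.mem_range.2
      (Nat.lt_succ_of_le (Finset.le_sup (f := ids) (Finset.mem_univ v)))))
    hids.injOn

theorem diam_lt_card {V : Type*} [Fintype V] {G : SimpleGraph V} (hG : G.Connected) :
    G.diam < Fintype.card V := by
  have := hG.nonempty
  obtain ⟨u, v, huv⟩ := G.exists_dist_eq_diam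
  obtain ⟨c, hc, hlen⟩ := hG.exists_path_of_dist u v
  rw [← huv, ← hlen]
  exact hc.length_lt

theorem maxDegree_lt_card [Nonempty V] : G.maxDegree < Fintype.card V := by
  obtain ⟨v, hv⟩ := G.exists_maximal_degree_vertex
  rw [hv]
  exact G.degree_lt_card_verts v

theorem maxDegree_pos [Nontrivial V] (hG : G.Connected) : 0 < G.maxDegree := by
  obtain ⟨v, w, hvw⟩ := exists_pair_ne V
  obtain ⟨u, hu⟩ := hG.preconnected.exists_adj_of_nontrivial v
  exact ((G.degree_pos_iff_exists_adj v).2 ⟨u, hu⟩).trans_le (G.degree_le_maxDegree v)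

theorem pairEquiv_lt {a b L : ℕ} (ha : a < 2 ^ L) (hb : b ≤ 2 ^ L) :
    Nat.pairEquiv (a, b) < 2 ^ (2 * L + 2) := by
  have h1 := Nat.pair_lt_max_add_one_sq a b
  have h2 : max a b + 1 ≤ 2 ^ (L + 1) := by
    have : 1 ≤ 2 ^ L := Nat.one_le_two_pow
    rw [pow_succ]
    omega
  calc Nat.pair a b < (max a b + 1) ^ 2 := h1
    _ ≤ (2 ^ (L + 1)) ^ 2 := Nat.pow_le_pow_left h2 2
    _ = 2 ^ (2 * L + 2) := by rw [← pow_mul]; congr 1; ring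

/-- All numbers that an agent stores have at most `2 * L + 2` bits, where `L` is the length of the
highest ID. -/
theorem length_code_le_of_table (hG : G.Connected) (hids : Function.Injective ids)
    {m : AgentMemory} {v : V} (hΔ : m.maxDeg = G.maxDegree) (hD : m.diam = G.diam)
    (hlam : m.lam = highestID ids) (hid : m.ownID = ids v)
    (hc : m.clock ≤ phaseLength G ids) (ha : m.alarm ≤ G.diam + 1) (hh : m.heard ≤ G.diam + 1)
    (htd : m.table.card ≤ G.maxDegree) (hdd : m.draft.card ≤ G.maxDegree)
    (ht : ∀ x ∈ m.table, (∃ w, x.1 = ids w) ∧ x.2 ≤ G.maxDegree + 1)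
    (hd : ∀ x ∈ m.draft, (∃ w, x.1 = ids w) ∧ x.2 ≤ G.maxDegree + 1) :
    m.code.length ≤ (8 + 2 * G.maxDegree) * (4 * (highestID ids).size + 5) := by
  have : Nonempty V := hG.nonempty
  set L := (highestID ids).size with hL
  have hlt : highestID ids < 2 ^ L := Nat.lt_size_self _
  have hle (w : V) : ids w < 2 ^ L := (Finset.le_sup (f := ids) (Finset.mem_univ w)).trans_lt hlt
  have hn := card_le_highestID_add_one hids
  have hΔn := maxDegree_lt_card (G := G)
  have hDn := diam_lt_card hG
  have hpow : 4 * 2 ^ L * 2 ^ L = 2 ^ (2 * L + 2) := by ring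
  have hpow' : 4 * 2 ^ L ≤ 2 ^ (2 * L + 2) := by
    rw [← hpow]
    exact Nat.le_mul_of_pos_right _ (by positivity)
  have hphase : phaseLength G ids < 2 ^ (2 * L + 2) := by
    have h1 : L < 2 ^ L := Nat.lt_two_pow_self
    have h2 : G.maxDegree < 2 ^ L := by omega
    calc phaseLength G ids = 4 * (G.maxDegree * L) := by rw [phaseLength]; ring
      _ < 4 * (2 ^ L * 2 ^ L) := by
        have := Nat.mul_lt_mul'' h2 h1
        omega
      _ = 2 ^ (2 * L + 2) := by rw [← hpow]; ring
  have hpair (x : ℕ × ℕ) (hx : (∃ w, x.1 = ids w) ∧ x.2 ≤ G.maxDegree + 1) :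
      Nat.pairEquiv x < 2 ^ (2 * L + 2) := by
    obtain ⟨⟨w, hw⟩, hx2⟩ := hx
    exact pairEquiv_lt (a := x.1) (b := x.2) (hw ▸ hle w) (by omega)
  have := hle v
  have hlen := AgentMemory.length_code_le (m := m) (d := G.maxDegree) (k := 2 * L + 2)
    (by omega) (by omega) (by omega) (by omega) (by omega) (by omega) (by omega) htd (by omega)
    hdd (fun x hx => hpair x (ht x hx)) (fun x hx => hpair x (hd x hx))
  rwa [show 2 * (2 * L + 2) + 1 = 4 * L + 5 by ring] at hlen

theorem length_code_memAt_le [DecidableEq V] (ports : PortNumbering G) (hG : G.Connected)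
    (hids : Function.Injective ids) (p : ℕ) {c : ℕ} (hc : c < phaseLength G ids) (v : V) :
    (memAt ports ids p c v).code.length ≤
      (8 + 2 * G.maxDegree) * (4 * (highestID ids).size + 5) := by
  refine length_code_le_of_table hG hids (v := v) rfl rfl rfl rfl hc.le (alarmLevel_le p v)
    (Finset.sup_le fun w _ => alarmLevel_le p w) ?_ ?_ ?_ ?_
  · refine (card_edgeTable_le (d := G.degree v) ?_).trans (G.degree_le_maxDegree v)
    rw [← G.card_neighborFinset_eq_degree]
    refine Finset.card_le_card fun w hw => ?_
    simpa using adj_of_estimate_ne_zero (Finset.mem_filter.1 hw).2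
  · refine Finset.card_image_le.trans ((Finset.card_le_card (seen_subset ports ids _ v)).trans ?_)
    rw [G.card_neighborFinset_eq_degree]
    exact G.degree_le_maxDegree v
  · intro x hx
    obtain ⟨w, -, rfl⟩ := mem_edgeTable.1 hx
    exact ⟨⟨w, rfl⟩, estimate_le_maxDegree_add_one p v w⟩
  · intro x hx
    obtain ⟨w, -, rfl⟩ := Finset.mem_image.1 hx
    exact ⟨⟨w, rfl⟩, estimate_le_maxDegree_add_one (p + 1) v w⟩

theorem size_sub_one_mul_log_two_le {x : ℕ} (hx : 0 < x) :
    ((x.size : ℝ) - 1) * Real.log 2 ≤ Real.log x := by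
  have hs : 0 < x.size := Nat.size_pos.2 hx
  have h : 2 ^ (x.size - 1) ≤ x := Nat.lt_size.1 (by omega)
  have h' : ((2 : ℝ) ^ (x.size - 1)) ≤ x := by exact_mod_cast h
  have := Real.log_le_log (by positivity) h'
  rwa [Real.log_pow, Nat.cast_sub hs, Nat.cast_one] at this

theorem size_le_three_mul_log {x : ℕ} (hx : 1 < x) : (x.size : ℝ) ≤ 3 * Real.log x := by
  have h1 := size_sub_one_mul_log_two_le (x := x) (by omega)
  have h2 : Real.log 2 ≤ Real.log x := Real.log_le_log (by norm_num) (by exact_mod_cast hx)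
  have h3 := Real.log_two_gt_d9
  have h4 : (0 : ℝ) ≤ x.size := Nat.cast_nonneg _
  nlinarith

theorem size_highestID_le {c : ℝ} (hn : 2 ≤ Fintype.card V) (hpos : 0 < highestID ids)
    (hc : ∀ v, (ids v : ℝ) ≤ (Fintype.card V : ℝ) ^ c) :
    ((highestID ids).size : ℝ) ≤ 2 * (|c| + 1) * Real.log (Fintype.card V) := by
  have : Nonempty V := Fintype.card_pos_iff.1 (by omega)
  obtain ⟨v, -, hv⟩ := Finset.exists_mem_eq_sup Finset.univ Finset.univ_nonempty ids
  have hv' : highestID ids = ids v := hv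
  have h1 := size_sub_one_mul_log_two_le hpos
  have hn0 : (0 : ℝ) < Fintype.card V := by positivity
  have h2 : Real.log (highestID ids) ≤ c * Real.log (Fintype.card V) := by
    rw [← Real.log_rpow hn0, hv']
    exact Real.log_le_log (by rw [← hv']; exact_mod_cast hpos) (hc v)
  have h3 : Real.log 2 ≤ Real.log (Fintype.card V) :=
    Real.log_le_log (by norm_num) (by exact_mod_cast hn)
  have h4 := Real.log_two_gt_d9
  have h5 : c * Real.log (Fintype.card V) ≤ |c| * Real.log (Fintype.card V) :=
    mul_le_mul_of_nonneg_right (le_abs_self c) (by linarith)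
  have h6 : (0 : ℝ) ≤ (highestID ids).size := Nat.cast_nonneg _
  nlinarith

theorem le_memory_bound {c : ℝ} {ℓ : ℕ} (hG : G.Connected) (hn : 2 ≤ Fintype.card V)
    (hpos : 0 < highestID ids) (hc : ∀ v, (ids v : ℝ) ≤ (Fintype.card V : ℝ) ^ c)
    (h : ℓ ≤ (8 + 2 * G.maxDegree) * (4 * (highestID ids).size + 5)) :
    (ℓ : ℝ) ≤ 180 * (|c| + 1) * (G.maxDegree * Real.log (Fintype.card V)) := by
  have : Nontrivial V := Fintype.one_lt_card_iff_nontrivial.1 hn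
  have hΔ := maxDegree_pos hG
  have hs : 0 < (highestID ids).size := Nat.size_pos.2 hpos
  have h1 : ℓ ≤ 90 * (G.maxDegree * (highestID ids).size) :=
    calc ℓ ≤ (8 + 2 * G.maxDegree) * (4 * (highestID ids).size + 5) := h
      _ ≤ (10 * G.maxDegree) * (9 * (highestID ids).size) :=
        Nat.mul_le_mul (by omega) (by omega)
      _ = _ := by ring
  calc (ℓ : ℝ) ≤ 90 * (G.maxDegree * (highestID ids).size) := by exact_mod_cast h1
    _ ≤ 90 * (G.maxDegree * (2 * (|c| + 1) * Real.log (Fintype.card V))) := by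
      gcongr
      exact size_highestID_le hn hpos hc
    _ = _ := by ring

theorem rounds_le {F : ℕ} (hG : G.Connected) (hn : 2 ≤ Fintype.card V)
    (hlam : 1 < highestID ids) (hF : F ≤ 2 * G.edgeFinset.card + 1) :
    ((phaseLength G ids * (F + G.diam + 1) : ℕ) : ℝ) ≤
      60 * (G.edgeFinset.card * G.maxDegree * G.diam * Real.log (highestID ids)) := by
  have : Nontrivial V := Fintype.one_lt_card_iff_nontrivial.1 hn
  have hD : 0 < G.diam := Nat.pos_of_ne_zero (SimpleGraph.connected_iff_diam_ne_zero.1 hG)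
  have hm : 0 < G.edgeFinset.card := by
    obtain ⟨v⟩ := hG.nonempty
    obtain ⟨w, hw⟩ := hG.preconnected.exists_adj_of_nontrivial v
    exact Finset.card_pos.2 ⟨s(v, w), SimpleGraph.mem_edgeFinset.2 hw⟩
  have h1 : F + G.diam + 1 ≤ 5 * (G.edgeFinset.card * G.diam) := by
    have : G.edgeFinset.card ≤ G.edgeFinset.card * G.diam := Nat.le_mul_of_pos_right _ hD
    have : G.diam ≤ G.edgeFinset.card * G.diam := Nat.le_mul_of_pos_left _ hm
    omega
  have h2 : phaseLength G ids * (F + G.diam + 1) ≤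
      20 * (G.edgeFinset.card * G.maxDegree * G.diam * (highestID ids).size) :=
    calc phaseLength G ids * (F + G.diam + 1)
        ≤ phaseLength G ids * (5 * (G.edgeFinset.card * G.diam)) := Nat.mul_le_mul_left _ h1
      _ = _ := by rw [phaseLength]; ring
  calc ((phaseLength G ids * (F + G.diam + 1) : ℕ) : ℝ)
      ≤ 20 * (G.edgeFinset.card * G.maxDegree * G.diam * (highestID ids).size) := by
        exact_mod_cast h2
    _ ≤ 20 * (G.edgeFinset.card * G.maxDegree * G.diam * (3 * Real.log (highestID ids))) := by
      gcongr
      exact size_le_three_mul_log hlam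
    _ = _ := by ring

end Bounds

/-! ### Graphs without a proper phase -/

section Small

variable {V : Type*} [Fintype V] [DecidableEq V] {G : SimpleGraph V} [DecidableRel G.Adj]
  (ports : PortNumbering G) (ids : V → ℕ)

theorem halted_nil : trussAlgorithm.halted [] = true := by
  simp [trussAlgorithm, AgentMemory.decode_nil]

theorem agentRun_mem_of_subsingleton [Subsingleton V] (t : ℕ) (v : V) :
    (agentRun G trussAlgorithm ports ids t v).mem = [] := by
  have h0 (v : V) : (agentRun G trussAlgorithm ports ids 0 v).mem = [] := by
    simp [agentRun, trussAlgorithm]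
  have := agentRun_mem_of_halted ports ids trussAlgorithm (T := 0)
    (fun v => by rw [h0, halted_nil]) t v
  rwa [zero_add, h0] at this

theorem solvesTrussDecomposition_of_subsingleton [Subsingleton V] :
    SolvesTrussDecomposition G trussAlgorithm ports ids 0 := by
  intro v
  rw [agentRun_mem_of_subsingleton]
  refine ⟨halted_nil, fun j k => ?_⟩
  have h : trussAlgorithm.output [] j = none := by
    simp [trussAlgorithm, AgentMemory.decode_nil, lookup]
  rw [h]
  simp only [reduceCtorEq, false_iff]
  rintro ⟨w, hw, -⟩
  exact hw.ne (Subsingleton.elim v w)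

/-- If the highest ID is at most `1` then the memories are constant. -/
theorem agentRun_mem_of_highestID_le_one (hΔ : G.maxDegree ≠ 0) (hlam : highestID ids ≤ 1)
    (t : ℕ) (v : V) : (agentRun G trussAlgorithm ports ids t v).mem =
      (AgentMemory.initial G.maxDegree G.diam (highestID ids) (ids v)).code := by
  have h0 (v : V) : (agentRun G trussAlgorithm ports ids 0 v).mem =
      (AgentMemory.initial G.maxDegree G.diam (highestID ids) (ids v)).code := by
    simp [agentRun, trussAlgorithm, hΔ]
  have := agentRun_mem_of_halted ports ids trussAlgorithm (T := 0)
    (fun v => by rw [h0, halted_code]; simp [AgentMemory.initial, hlam]) t v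
  rwa [zero_add, h0] at this

theorem ids_of_adj {V : Type*} [Fintype V] {G : SimpleGraph V} (ids : V → ℕ)
    (hids : Function.Injective ids) (hlam : highestID ids ≤ 1) {v w : V}
    (h : G.Adj v w) : ids w = 1 - ids v := by
  have h1 : ids v ≤ highestID ids := Finset.le_sup (Finset.mem_univ v)
  have h2 : ids w ≤ highestID ids := Finset.le_sup (Finset.mem_univ w)
  have h3 : ids v ≠ ids w := hids.ne h.ne
  omega

/-- Two distinct IDs up to `1` leave no room for a third node, so the edge is in no triangle. -/
theorem trussness_eq_two {V : Type*} [Fintype V] {G : SimpleGraph V} [DecidableRel G.Adj]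
    (ids : V → ℕ) (hids : Function.Injective ids) (hlam : highestID ids ≤ 1) {v w : V}
    (h : G.Adj v w) : trussness G s(v, w) = 2 := by
  have h1 := trussness_le_estimate h 1
  have h2 := estimate_two_le_support (G := G) 0 v w
  have h3 : (Finset.univ.filter fun x => (G.Adj v x ∧ G.Adj w x) ∧
      estimate G (0 + 2) v w ≤ estimate G (0 + 1) v x ∧
      estimate G (0 + 2) v w ≤ estimate G (0 + 1) w x) = ∅ := by
    refine Finset.filter_eq_empty_iff.2 fun x _ hx => hx.1.2.ne (hids ?_)
    rw [ids_of_adj ids hids hlam h, ids_of_adj ids hids hlam hx.1.1]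
  rw [h3, Finset.card_empty] at h2
  have h4 : (kTruss G 2).Adj v w :=
    (kTruss_isGreatest G 2).2 ⟨le_rfl, fun _ _ => Nat.le_add_left 2 _⟩ h
  have h5 := (mem_kTruss_iff_le_trussness G (e := s(v, w)) h 2).1 h4
  change _ ≤ estimate G (0 + 2) v w at h1
  omega

theorem solvesTrussDecomposition_of_highestID_le_one [Nontrivial V] (hG : G.Connected)
    (hids : Function.Injective ids) (hlam : highestID ids ≤ 1) :
    SolvesTrussDecomposition G trussAlgorithm ports ids 0 := by
  intro v
  rw [agentRun_mem_of_highestID_le_one ports ids (maxDegree_pos hG).ne' hlam, halted_code]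
  refine ⟨by simp [AgentMemory.initial, hlam], fun j k => ?_⟩
  have htable : (AgentMemory.initial G.maxDegree G.diam (highestID ids) (ids v)).table =
      {(1 - ids v, 2)} := by simp [AgentMemory.initial, hlam]
  rw [output_code_eq_some_iff, htable, lookup, Finset.filter_singleton]
  constructor
  · rintro ⟨hk, h⟩
    split_ifs at h with hj
    · obtain ⟨w, hw⟩ := hG.preconnected.exists_adj_of_nontrivial v
      exact ⟨w, hw, (ids_of_adj ids hids hlam hw).trans hj,
        (trussness_eq_two ids hids hlam hw).trans (by simpa using h)⟩
    · exact absurd h.symm hk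
  · rintro ⟨w, hw, rfl, rfl⟩
    rw [trussness_eq_two ids hids hlam hw, if_pos (ids_of_adj ids hids hlam hw).symm]
    simp

theorem length_code_initial_le {V : Type*} [Fintype V] [Nontrivial V] {G : SimpleGraph V}
    [DecidableRel G.Adj] (ids : V → ℕ) (hG : G.Connected) (hids : Function.Injective ids)
    (hlam : highestID ids ≤ 1) (v : V) :
    (AgentMemory.initial G.maxDegree G.diam (highestID ids) (ids v)).code.length ≤
      (8 + 2 * G.maxDegree) * (4 * (highestID ids).size + 5) := by
  have hΔ := maxDegree_pos hG
  refine length_code_le_of_table hG hids (v := v) rfl rfl rfl rfl (Nat.zero_le _) ?_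
    (Nat.zero_le _) ?_ (Nat.zero_le _) ?_ (fun x hx => absurd hx (Finset.notMem_empty x))
  · simp [AgentMemory.initial, hlam]
  · simpa [AgentMemory.initial, hlam] using Nat.succ_le_of_lt hΔ
  · intro x hx
    obtain ⟨w, hw⟩ := hG.preconnected.exists_adj_of_nontrivial v
    simp only [AgentMemory.initial, hlam, if_true, Finset.mem_singleton] at hx
    subst hx
    exact ⟨⟨w, (ids_of_adj ids hids hlam hw).symm⟩, by change 2 ≤ _; omega⟩

end Small

/-! ### The time and memory bounds of the algorithm -/

theorem mainTheorem2 :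
    ∃ (A : AgentAlgorithm) (K : ℝ), ∀ c : ℝ, ∃ C : ℝ,
      ∀ (V : Type*) [Fintype V] [DecidableEq V] (G : SimpleGraph V) [DecidableRel G.Adj]
        (ports : PortNumbering G) (ids : V → ℕ),
        G.Connected → Function.Injective ids →
        (∀ v, (ids v : ℝ) ≤ (Fintype.card V : ℝ) ^ c) →
        (∃ T : ℕ,
          (T : ℝ) ≤ K * (G.edgeFinset.card * G.maxDegree * G.diam *
            Real.log (highestID ids)) ∧
          SolvesTrussDecomposition G A ports ids T) ∧
        ∀ (t : ℕ) (v : V),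
          ((agentRun G A ports ids t v).mem.length : ℝ) ≤
            C * (G.maxDegree * Real.log (Fintype.card V)) := by
  refine ⟨trussAlgorithm, 60, fun c => ⟨180 * (|c| + 1), ?_⟩⟩
  intro V _ _ G _ ports ids hG hids hc
  have hlog : 0 ≤ Real.log (highestID ids) := Real.log_natCast_nonneg _
  rcases subsingleton_or_nontrivial V with hV | hV
  · refine ⟨⟨0, ?_, solvesTrussDecomposition_of_subsingleton ports ids⟩, fun t v => ?_⟩
    · rw [Nat.cast_zero]
      positivity
    · have : 0 ≤ Real.log (Fintype.card V) := Real.log_natCast_nonneg _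
      rw [agentRun_mem_of_subsingleton, List.length_nil, Nat.cast_zero]
      positivity
  have hn : 2 ≤ Fintype.card V := Fintype.one_lt_card
  have hΔ : G.maxDegree ≠ 0 := (maxDegree_pos hG).ne'
  have hpos : 0 < highestID ids := by
    have := card_le_highestID_add_one hids
    omega
  rcases le_or_gt (highestID ids) 1 with hlam | hlam
  -- If the highest ID is `1` then `log 1 = 0`, so that no round is available.
  · refine ⟨⟨0, ?_, solvesTrussDecomposition_of_highestID_le_one ports ids hG hids hlam⟩,
      fun t v => le_memory_bound hG hn hpos hc ?_⟩
    · rw [Nat.cast_zero]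
      positivity
    · rw [agentRun_mem_of_highestID_le_one ports ids hΔ hlam]
      exact length_code_initial_le ids hG hids hlam v
  · have hex := exists_estimate_stable (G := G)
    classical
    -- The first phase without a change is followed by `diam + 1` phases until all alarms are `0`.
    have hex' : ∃ q, estimate G (q + 1) = estimate G q := hex.imp fun _ h => h.2
    obtain ⟨q, hq, hstable⟩ := hex
    have hF := Nat.find_spec hex'
    have hFq : Nat.find hex' ≤ 2 * G.edgeFinset.card + 1 := (Nat.find_min' hex' hstable).trans hq
    have halarm (p : ℕ) (hp : p < Nat.find hex' + G.diam + 1) (v : V) : 0 < alarmLevel G p v :=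
      alarmLevel_pos hG (fun r hr => Nat.find_min hex' hr) (by omega) v
    refine ⟨⟨_, rounds_le hG hn hlam hFq,
      solvesTrussDecomposition_of_stable ports ids hids hΔ hlam halarm hF⟩, fun t v => ?_⟩
    obtain ⟨p, k, hk, hmem⟩ := exists_agentRun_mem_eq ports ids hids hΔ hlam halarm
      (alarmLevel_eq_zero hF) t v
    rw [hmem]
    exact le_memory_bound hG hn hpos hc (length_code_memAt_le ports hG hids p hk v)
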